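/- A \emph{configuration structure} is a pair $\langle E,C\rangle$ with $E$ a set (of \emph{events}) and $C\subseteq\mathcal P(E)$ (the \emph{configurations}). Call $X\subseteq E$ \emph{consistent} if $X\subseteq z$ for some $z\in C$, and \emph{pairwise consistent} if every $Y\subseteq X$ with $|Y|\le 2$ is consistent. The structure $\langle E,C\rangle$ is \begin{itemize} \item \emph{rooted} if $\emptyset\in C$; \item said to satisfy the \emph{axiom of finiteness} if every $x\in C$ is the union of all finite $y\in C$ with $y\subseteq x$; \item \emph{coincidence-free} if for every $x\in C$ and all distinct $d,e\in x$ there is a $y\in C$ with $y\subseteq x$ containing exactly one of $d$ and $e$; \item \emph{closed under pairwise consistent unions} if $\bigcup A\in C$ for every $A\subseteq C$ with $\bigcup A$ pairwise consistent; \item \emph{closed under bounded nonempty intersections} if $\bigcap A\in C$ for every nonempty $A\subseteq C$ with $\bigcup A$ consistent. \end{itemize} An \emph{event structure in the sense of Winskel (1989)} is a triple $\langle E,\#,\vdash\rangle$ where $E$ is a set, $\#\subseteq E\times E$ is symmetric and irreflexive, and $\vdash\;\subseteq \mathrm{Con}\times E$ satisfies: $X\vdash e$ and $X\subseteq Y\in\mathrm{Con}$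 imply $Y\vdash e$. Here $X\subseteq E$ is \emph{conflict-free} if $\neg(d\,\#\,e)$ for all $d,e\in X$, and $\mathrm{Con}$ is the set of finite conflict-free subsets of $E$. It is \emph{stable} if $X\vdash e$, $Y\vdash e$ and $X\cup Y\cup\{e\}\in\mathrm{Con}$ imply $X\cap Y\vdash e$. Its \emph{(secured) configurations} are the conflict-free sets $X\subseteq E$ such that for every $e\in X$ there are $e_0,\dots,e_n\in X$ with $e_n=e$ and $\{e_0,\dots,e_{i-1}\}\vdash e_i$ for all $i\le n$. \textbf{Corollary.} Let $\langle E,C\rangle$ be a configuration structure. \begin{enumerate} \item $C$ is the family of (secured) configurations of some event structure $\langle E,\#,\vdash\rangle$ in the sense of Winskel (1989) if and only if $\langle E,C\rangle$ is rooted, satisfies the axiom of finiteness, is coincidence-free and is closed under pairwise consistent unions. \item $C$ is the family of (secured) configurations of some stable event structure $\langle E,\#,\vdash\rangle$ in the sense of Winskel (1989) if and only if $\langle E,C\rangle$ has all the properties listed in item 1 and is moreover closed under bounded nonempty intersections. \end{enumerate} -/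

import Mathlib

/-- A (pure) configuration structure, i.e. a set system, over the set `E` of events. -/
@[ext]
structure ConfigurationStructure (E : Type*) where
  /-- the set of configurations -/
  configs : Set (Set E)

namespace ConfigurationStructure

variable {E : Type*} (C : ConfigurationStructure E)

/-- The empty set of events is a configuration. -/
def Rooted : Prop := ∅ ∈ C.configs

/-- Axiom of finiteness: any configuration is the union of its finite subconfigurations. -/
def AxiomOfFiniteness : Prop :=
  ∀ x ∈ C.configs, x = ⋃₀ {y | y ∈ C.configs ∧ y.Finite ∧ y ⊆ x}

/-- For every two distinct events occurring in a configuration there is a subconfiguration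
containing one but not the other. -/
def CoincidenceFree : Prop :=
  ∀ x ∈ C.configs, ∀ d ∈ x, ∀ e ∈ x, d ≠ e →
    ∃ y ∈ C.configs, y ⊆ x ∧ ((d ∈ y ∧ e ∉ y) ∨ (e ∈ y ∧ d ∉ y))

/-- A set of events is consistent if it is contained in a configuration. -/
def Consistent (X : Set E) : Prop := ∃ z ∈ C.configs, X ⊆ z

/-- A set of events is pairwise consistent if its subsets with at most two elements are
consistent. -/
def PairwiseConsistent (X : Set E) : Prop :=
  ∀ Y ⊆ X, Y.encard ≤ 2 → C.Consistent Y

/-- Closure under pairwise consistent unions. -/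
def ClosedUnderPairwiseConsistentUnions : Prop :=
  ∀ A ⊆ C.configs, C.PairwiseConsistent (⋃₀ A) → ⋃₀ A ∈ C.configs

/-- Closure under bounded nonempty intersections. -/
def ClosedUnderBoundedNonemptyIntersections : Prop :=
  ∀ A ⊆ C.configs, A.Nonempty → C.Consistent (⋃₀ A) → ⋂₀ A ∈ C.configs

end ConfigurationStructure

/-- A set of events is conflict-free w.r.t. a conflict relation. -/
def ConflictFree {E : Type*} (conflict : E → E → Prop) (X : Set E) : Prop :=
  ∀ d ∈ X, ∀ e ∈ X, ¬ conflict d e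

/-- An event structure `⟨E, #, ⊢⟩` in the sense of Winskel (1989). The enabling relation is a
relation between finite conflict-free sets of events and events. -/
structure WinskelEventStructure (E : Type*) where
  /-- the conflict relation `#` -/
  conflict : E → E → Prop
  conflict_symm : ∀ d e, conflict d e → conflict e d
  conflict_irrefl : ∀ e, ¬ conflict e e
  /-- the enabling relation `⊢` -/
  enables : Set E → E → Prop
  enables_finite : ∀ X e, enables X e → X.Finite
  enables_conflictFree : ∀ X e, enables X e → ConflictFree conflict X
  enables_mono : ∀ X Y e, enables X e → X ⊆ Y → Y.Finite → ConflictFree conflict Y → enables Y e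

namespace WinskelEventStructure

variable {E : Type*} (S : WinskelEventStructure E)

/-- `Con`: the set of finite, conflict-free sets of events. -/
def Con : Set (Set E) := {X | X.Finite ∧ ConflictFree S.conflict X}

/-- Stability: `X ⊢ e`, `Y ⊢ e` and `X ∪ Y ∪ {e} ∈ Con` imply `X ∩ Y ⊢ e`. -/
def Stable : Prop :=
  ∀ X Y e, S.enables X e → S.enables Y e → X ∪ Y ∪ {e} ∈ S.Con → S.enables (X ∩ Y) e

/-- `X` is secured: for each `e ∈ X` there are `s 0, …, s n ∈ X` with `s n = e` and
`{s 0, …, s (i - 1)} ⊢ s i` for all `i ≤ n` (the values of `s` beyond `n` are irrelevant). -/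
def Secured (X : Set E) : Prop :=
  ∀ e ∈ X, ∃ (n : ℕ) (s : ℕ → E), (∀ i ≤ n, s i ∈ X) ∧ s n = e ∧
    ∀ i ≤ n, S.enables {d | ∃ j < i, d = s j} (s i)

/-- The configuration structure given by the family of (secured) configurations, i.e. the
conflict-free and secured sets of events. -/
def configurationStructure : ConfigurationStructure E where
  configs := {X | ConflictFree S.conflict X ∧ S.Secured X}

end WinskelEventStructure

/-! By `secured_iff`, a set is secured exactly when it is covered by its reachable subsets, the
finite sets built one enabled event at a time. The necessary conditions follow from this covering.
In the stable case an enabled event of a conflict-free set has a least enabling subset there, which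
every configuration below that set containing the event must include; hence intersections stay
secured.

Conversely, `toWinskel` takes binary inconsistency as conflict and lets `y \ {e} ⊆ X` enable `e`
when `y` and `y \ {e}` are configurations. Finite configurations are reachable because they can be
climbed one event at a time (`exists_insert_mem`); conflict-free reachable sets are configurations
by closure under unions. Finiteness and unions extend this to infinite sets, and closure under
intersections makes `toWinskel` stable. -/

namespace ConfigurationStructure

variable {E : Type*} {C : ConfigurationStructure E}

theorem AxiomOfFiniteness.exists_finite_mem (h : C.AxiomOfFiniteness) {x : Set E}
    (hx : x ∈ C.configs) {e : E} (he : e ∈ x) :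
    ∃ y ∈ C.configs, y.Finite ∧ y ⊆ x ∧ e ∈ y := by
  rw [h x hx] at he
  obtain ⟨y, ⟨hy, hfin, hyx⟩, hey⟩ := he
  exact ⟨y, hy, hfin, hyx, hey⟩

theorem Consistent.pairwiseConsistent {X : Set E} (h : C.Consistent X) :
    C.PairwiseConsistent X := by
  obtain ⟨z, hz, hXz⟩ := h
  exact fun Y hY _ => ⟨z, hz, hY.trans hXz⟩

theorem pairwiseConsistent_of_pair {X : Set E} (hne : C.configs.Nonempty)
    (h : ∀ d ∈ X, ∀ e ∈ X, C.Consistent {d, e}) : C.PairwiseConsistent X := by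
  intro Y hYX hY
  rcases Y.eq_empty_or_nonempty with rfl | ⟨d, hd⟩
  · obtain ⟨z, hz⟩ := hne
    exact ⟨z, hz, Set.empty_subset z⟩
  · by_cases hex : ∃ e ∈ Y, e ≠ d
    · obtain ⟨e, he, hed⟩ := hex
      have hsub : ({d, e} : Set E) ⊆ Y := Set.insert_subset hd (Set.singleton_subset_iff.2 he)
      have heq : ({d, e} : Set E) = Y :=
        (Set.toFinite _).eq_of_subset_of_encard_le hsub (by rwa [Set.encard_pair hed.symm])
      exact heq ▸ h d (hYX hd) e (hYX he)
    · push Not at hex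
      obtain ⟨z, hz, hdz⟩ := h d (hYX hd) d (hYX hd)
      exact ⟨z, hz, fun e he => hdz (by simp [hex e he])⟩

theorem ClosedUnderPairwiseConsistentUnions.union_mem
    (h : C.ClosedUnderPairwiseConsistentUnions) {x y : Set E} (hx : x ∈ C.configs)
    (hy : y ∈ C.configs) (hxy : C.PairwiseConsistent (x ∪ y)) : x ∪ y ∈ C.configs := by
  rw [← Set.sUnion_pair] at hxy ⊢
  exact h _ (Set.insert_subset hx (Set.singleton_subset_iff.2 hy)) hxy

theorem ClosedUnderBoundedNonemptyIntersections.inter_mem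
    (h : C.ClosedUnderBoundedNonemptyIntersections) {x y : Set E} (hx : x ∈ C.configs)
    (hy : y ∈ C.configs) (hxy : C.Consistent (x ∪ y)) : x ∩ y ∈ C.configs := by
  rw [← Set.sUnion_pair] at hxy
  rw [← Set.sInter_pair]
  exact h _ (Set.insert_subset hx (Set.singleton_subset_iff.2 hy)) (Set.insert_nonempty _ _) hxy

/-- A configuration properly below a finite configuration `y` can be enlarged by a single event
to a configuration below `y`. -/
theorem exists_insert_mem (hcf : C.CoincidenceFree) (hun : C.ClosedUnderPairwiseConsistentUnions)
    {x y : Set E} (hx : x ∈ C.configs) (hy : y ∈ C.configs) (hfin : y.Finite) (hxy : x ⊂ y) :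
    ∃ e, e ∉ x ∧ insert e x ∈ C.configs ∧ insert e x ⊆ y := by
  have hT : {w | w ∈ C.configs ∧ x ⊂ w ∧ w ⊆ y}.Finite :=
    hfin.finite_subsets.subset fun w hw => hw.2.2
  obtain ⟨w, ⟨hw, hxw, hwy⟩, hmin⟩ := hT.exists_minimal ⟨y, hy, hxy, subset_rfl⟩
  obtain ⟨e, hew, hex⟩ := Set.exists_of_ssubset hxw
  -- By minimality of `w`, any subconfiguration that adds something to `x` must already add all of
  -- `w \ x`, so none can separate two events of `w \ x`.
  have hgrow : ∀ z ∈ C.configs, z ⊆ w → ∀ a ∈ z, a ∉ x → w ⊆ x ∪ z := by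
    intro z hz hzw a haz hax
    have hsub : x ∪ z ⊆ w := Set.union_subset hxw.subset hzw
    refine hmin ⟨hun.union_mem hx hz (Consistent.pairwiseConsistent ⟨w, hw, hsub⟩), ?_,
      hsub.trans hwy⟩ hsub
    exact ⟨Set.subset_union_left, fun hc => hax (hc (Or.inr haz))⟩
  have heq : insert e x = w := by
    refine Set.Subset.antisymm (Set.insert_subset hew hxw.subset) fun d hd => ?_
    by_contra hne
    obtain ⟨hde, hdx⟩ : d ≠ e ∧ d ∉ x := by simpa using hne
    obtain ⟨z, hz, hzw, ⟨hdz, hez⟩ | ⟨hez, hdz⟩⟩ := hcf w hw d hd e hew hde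
    · exact (hgrow z hz hzw d hdz hdx hew).elim hex hez
    · exact (hgrow z hz hzw e hez hex hd).elim hdx hdz
  exact ⟨e, hex, heq ▸ hw, heq ▸ hwy⟩

end ConfigurationStructure

theorem ConflictFree.subset {E : Type*} {r : E → E → Prop} {X Y : Set E} (h : ConflictFree r Y)
    (hXY : X ⊆ Y) : ConflictFree r X :=
  fun d hd e he => h d (hXY hd) e (hXY he)

/-! ### Reachable sets and securedness -/

namespace WinskelEventStructure

variable {E : Type*} (S : WinskelEventStructure E)

/-- The finite sets of events that are obtained from the empty set by successively adding enabled
events. -/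
inductive Reachable : Set E → Prop
  | empty : Reachable ∅
  | step {X : Set E} {e : E} : Reachable X → S.enables X e → Reachable (insert e X)

variable {S}

theorem Reachable.finite {X : Set E} (h : S.Reachable X) : X.Finite := by
  induction h with
  | empty => exact Set.finite_empty
  | step _ _ ih => exact ih.insert _

theorem Reachable.union {X Y : Set E} (hX : S.Reachable X) (hY : S.Reachable Y)
    (h : ConflictFree S.conflict (X ∪ Y)) : S.Reachable (X ∪ Y) := by
  induction hY with
  | empty => simpa using hX
  | @step Y e hY he ih =>
    have hsub : X ∪ Y ⊆ X ∪ insert e Y := Set.union_subset_union_right _ (Set.subset_insert _ _)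
    rw [Set.union_insert]
    exact (ih (h.subset hsub)).step (S.enables_mono _ _ _ he Set.subset_union_right
      (hX.finite.union hY.finite) (h.subset hsub))

theorem reachable_of_sequence {n : ℕ} {s : ℕ → E}
    (h : ∀ i < n, S.enables {d | ∃ j < i, d = s j} (s i)) :
    S.Reachable {d | ∃ j < n, d = s j} := by
  induction n with
  | zero => simpa using Reachable.empty
  | succ n ih =>
    have heq : {d | ∃ j < n + 1, d = s j} = insert (s n) {d | ∃ j < n, d = s j} := by
      ext d
      simp only [Nat.lt_succ_iff_lt_or_eq, Set.mem_ofPred_eq, Set.mem_insert_iff]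
      constructor
      · rintro ⟨j, hj | rfl, rfl⟩
        exacts [Or.inr ⟨j, hj, rfl⟩, Or.inl rfl]
      · rintro (rfl | ⟨j, hj, rfl⟩)
        exacts [⟨n, Or.inr rfl, rfl⟩, ⟨j, Or.inl hj, rfl⟩]
    rw [heq]
    exact (ih fun i hi => h i (hi.trans n.lt_succ_self)).step (h n n.lt_succ_self)

theorem Reachable.exists_sequence [Nonempty E] {X : Set E} (hX : S.Reachable X) :
    ∃ (n : ℕ) (s : ℕ → E), X = {d | ∃ j < n, d = s j} ∧
      ∀ i < n, S.enables {d | ∃ j < i, d = s j} (s i) := by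
  induction hX with
  | empty => exact ⟨0, fun _ => Classical.arbitrary E, by simp, by simp⟩
  | @step X e _ he ih =>
    obtain ⟨n, s, rfl, hs⟩ := ih
    -- The new event is stored at index `n`, which no prefix of length at most `n` reads.
    have hprefix : ∀ i ≤ n,
        {d | ∃ j < i, d = Function.update s n e j} = {d | ∃ j < i, d = s j} := by
      intro i hi
      ext d
      refine exists_congr fun j => and_congr_right fun hj => ?_
      rw [Function.update_of_ne (by omega)]
    refine ⟨n + 1, Function.update s n e, ?_, fun i hi => ?_⟩
    · rw [← hprefix n le_rfl]
      ext d
      simp only [Nat.lt_succ_iff_lt_or_eq, Set.mem_ofPred_eq, Set.mem_insert_iff]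
      constructor
      · rintro (rfl | ⟨j, hj, rfl⟩)
        exacts [⟨n, Or.inr rfl, by simp⟩, ⟨j, Or.inl hj, rfl⟩]
      · rintro ⟨j, hj | rfl, rfl⟩
        exacts [Or.inr ⟨j, hj, rfl⟩, Or.inl (by simp)]
    · rw [hprefix i (by omega)]
      rcases Nat.lt_succ_iff_lt_or_eq.1 hi with hi | rfl
      · rw [Function.update_of_ne hi.ne]
        exact hs i hi
      · rwa [Function.update_self]

theorem secured_iff {X : Set E} :
    S.Secured X ↔ ∀ e ∈ X, ∃ Y ⊆ X, S.Reachable Y ∧ e ∈ Y := by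
  refine forall₂_congr fun e he => ⟨?_, ?_⟩
  · rintro ⟨n, s, hsX, rfl, hs⟩
    refine ⟨{d | ∃ j < n + 1, d = s j}, ?_,
      reachable_of_sequence fun i hi => hs i (Nat.lt_succ_iff.1 hi), n, n.lt_succ_self, rfl⟩
    rintro _ ⟨j, hj, rfl⟩
    exact hsX j (Nat.lt_succ_iff.1 hj)
  · rintro ⟨Y, hYX, hY, heY⟩
    have : Nonempty E := ⟨e⟩
    obtain ⟨n, s, rfl, hs⟩ := hY.exists_sequence
    obtain ⟨j, hj, rfl⟩ := heY
    exact ⟨j, s, fun i hi => hYX ⟨i, by omega, rfl⟩, rfl, fun i hi => hs i (by omega)⟩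

theorem mem_configs_iff {X : Set E} : X ∈ S.configurationStructure.configs ↔
    ConflictFree S.conflict X ∧ ∀ e ∈ X, ∃ Y ⊆ X, S.Reachable Y ∧ e ∈ Y := by
  rw [← secured_iff]
  rfl

theorem Reachable.mem_configs {X : Set E} (hX : S.Reachable X)
    (h : ConflictFree S.conflict X) : X ∈ S.configurationStructure.configs :=
  mem_configs_iff.2 ⟨h, fun _ he => ⟨X, subset_rfl, hX, he⟩⟩

/-- Each event of a reachable set is enabled by a reachable subset not containing it. -/
theorem Reachable.exists_enables {X : Set E} (hX : S.Reachable X) {e : E} (he : e ∈ X) :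
    ∃ Y ⊆ X, S.Reachable Y ∧ e ∉ Y ∧ S.enables Y e := by
  induction hX with
  | empty => exact he.elim
  | @step X a hX ha ih =>
    by_cases heX : e ∈ X
    · obtain ⟨Y, hYX, hY⟩ := ih heX
      exact ⟨Y, hYX.trans (Set.subset_insert _ _), hY⟩
    · obtain rfl : e = a := he.resolve_right heX
      exact ⟨X, Set.subset_insert _ _, hX, heX, ha⟩

/-- Finitely many events of a secured set lie in a common reachable subset. -/
theorem exists_reachable_superset {X F : Set E} (hX : ConflictFree S.conflict X)
    (hF : F.Finite) (h : ∀ e ∈ F, ∃ Y ⊆ X, S.Reachable Y ∧ e ∈ Y) :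
    ∃ Y ⊆ X, S.Reachable Y ∧ F ⊆ Y := by
  induction F, hF using Set.Finite.induction_on with
  | empty => exact ⟨∅, Set.empty_subset _, .empty, subset_rfl⟩
  | @insert a F _ _ ih =>
    obtain ⟨Y, hYX, hY, hFY⟩ := ih fun e he => h e (Or.inr he)
    obtain ⟨Z, hZX, hZ, haZ⟩ := h a (Or.inl rfl)
    have hsub := Set.union_subset hYX hZX
    exact ⟨Y ∪ Z, hsub, hY.union hZ (hX.subset hsub),
      Set.insert_subset (Or.inr haZ) (hFY.trans Set.subset_union_left)⟩

/-! ### Closure properties of secured configurations -/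

variable (S)

theorem rooted : S.configurationStructure.Rooted :=
  Reachable.empty.mem_configs fun _ h => h.elim

theorem axiomOfFiniteness : S.configurationStructure.AxiomOfFiniteness := by
  intro x hx
  refine Set.Subset.antisymm (fun e he => ?_) (Set.sUnion_subset fun y hy => hy.2.2)
  obtain ⟨hcf, hsec⟩ := mem_configs_iff.1 hx
  obtain ⟨Y, hYx, hY, heY⟩ := hsec e he
  exact ⟨Y, ⟨hY.mem_configs (hcf.subset hYx), hY.finite, hYx⟩, heY⟩

theorem coincidenceFree : S.configurationStructure.CoincidenceFree := by
  intro x hx d hd e he hde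
  obtain ⟨hcf, hsec⟩ := mem_configs_iff.1 hx
  obtain ⟨Y, hYx, hY, hdY⟩ := hsec d hd
  -- If `Y` contains both events, cut its construction just before `d`: either the part built so far
  -- contains `e`, or adding `d` to it separates the two.
  by_cases heY : e ∈ Y
  · obtain ⟨Z, hZY, hZ, hdZ, hen⟩ := hY.exists_enables hdY
    by_cases heZ : e ∈ Z
    · exact ⟨Z, hZ.mem_configs (hcf.subset (hZY.trans hYx)), hZY.trans hYx, Or.inr ⟨heZ, hdZ⟩⟩
    · have hsub : insert d Z ⊆ x := Set.insert_subset hd (hZY.trans hYx)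
      exact ⟨insert d Z, (hZ.step hen).mem_configs (hcf.subset hsub), hsub,
        Or.inl ⟨Set.mem_insert _ _, by simp [hde.symm, heZ]⟩⟩
  · exact ⟨Y, hY.mem_configs (hcf.subset hYx), hYx, Or.inl ⟨hdY, heY⟩⟩

theorem closedUnderPairwiseConsistentUnions :
    S.configurationStructure.ClosedUnderPairwiseConsistentUnions := by
  intro A hA hpc
  refine mem_configs_iff.2 ⟨fun d hd e he => ?_, ?_⟩
  · obtain ⟨z, hz, hsub⟩ := hpc {d, e}
      (Set.insert_subset hd (Set.singleton_subset_iff.2 he)) (by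
        simpa [one_add_one_eq_two] using Set.encard_insert_le {e} d)
    exact (mem_configs_iff.1 hz).1 d (hsub (by simp)) e (hsub (by simp))
  · rintro e ⟨x, hx, he⟩
    obtain ⟨Y, hYx, hY⟩ := (mem_configs_iff.1 (hA hx)).2 e he
    exact ⟨Y, hYx.trans (Set.subset_sUnion_of_mem hx), hY⟩

/-! ### Stability and intersections -/

variable {S}

/-- In a stable event structure, if some subset of a conflict-free set `z` enables an event `e` of
`z`, then there is a least such subset. -/
theorem Stable.exists_enables_subset (hS : S.Stable) {X z : Set E} {e : E}
    (hz : ConflictFree S.conflict z) (hX : S.enables X e) (hXz : X ⊆ z) (hez : e ∈ z) :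
    ∃ W ⊆ X, S.enables W e ∧ ∀ Y ⊆ z, S.enables Y e → W ⊆ Y := by
  have hT : {W | W ⊆ X ∧ S.enables W e}.Finite :=
    (S.enables_finite X e hX).finite_subsets.subset fun W hW => hW.1
  obtain ⟨W, ⟨hWX, hW⟩, hmin⟩ := hT.exists_minimal ⟨X, subset_rfl, hX⟩
  refine ⟨W, hWX, hW, fun Y hYz hY => ?_⟩
  have hcon : W ∪ Y ∪ {e} ∈ S.Con :=
    ⟨((S.enables_finite W e hW).union (S.enables_finite Y e hY)).union (Set.finite_singleton e),
      hz.subset (Set.union_subset (Set.union_subset (hWX.trans hXz) hYz)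
        (Set.singleton_subset_iff.2 hez))⟩
  exact (hmin ⟨Set.inter_subset_left.trans hWX, hS W Y e hW hY hcon⟩
    Set.inter_subset_left).trans Set.inter_subset_right

theorem Stable.closedUnderBoundedNonemptyIntersections (hS : S.Stable) :
    S.configurationStructure.ClosedUnderBoundedNonemptyIntersections := by
  rintro A hA ⟨x, hx⟩ ⟨z, hz, hAz⟩
  have hsub : ∀ y ∈ A, y ⊆ z := fun y hy => (Set.subset_sUnion_of_mem hy).trans hAz
  have hzcf := (mem_configs_iff.1 hz).1
  have hcf : ConflictFree S.conflict (⋂₀ A) :=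
    hzcf.subset ((Set.sInter_subset_of_mem hx).trans (hsub x hx))
  have key : ∀ X : Set E, S.Reachable X → X ⊆ x →
      ∀ e ∈ X, e ∈ ⋂₀ A → ∃ Y ⊆ ⋂₀ A, S.Reachable Y ∧ e ∈ Y := by
    intro X hX
    induction hX with
    | empty => exact fun _ e he => he.elim
    | @step X a _ ha ih =>
      rintro hXx e (rfl | he) heA
      · have hXx' : X ⊆ x := (Set.subset_insert _ _).trans hXx
        obtain ⟨W, hWX, hW, hmin⟩ := hS.exists_enables_subset hzcf ha (hXx'.trans (hsub x hx))
          (hsub x hx (heA x hx))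
        -- Each `y ∈ A` contains `e`, hence a set enabling `e`, and the least enabling set `W` lies
        -- inside it.
        have hWA : W ⊆ ⋂₀ A := by
          refine Set.subset_sInter fun y hy => ?_
          obtain ⟨Y, hYy, hY, heY⟩ := (mem_configs_iff.1 (hA hy)).2 e (heA y hy)
          obtain ⟨Z, hZY, -, -, hZ⟩ := hY.exists_enables heY
          exact (hmin Z ((hZY.trans hYy).trans (hsub y hy)) hZ).trans (hZY.trans hYy)
        -- `W` itself need not be reachable, but it is finite and the induction hypothesis covers
        -- each of its events.
        obtain ⟨Y, hYA, hY, hWY⟩ := exists_reachable_superset hcf (S.enables_finite W e hW)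
          fun d hd => ih hXx' d (hWX hd) (hWA hd)
        exact ⟨insert e Y, Set.insert_subset heA hYA,
          hY.step (S.enables_mono W Y e hW hWY hY.finite (hcf.subset hYA)), Set.mem_insert _ _⟩
      · exact ih ((Set.subset_insert _ _).trans hXx) e he heA
  refine mem_configs_iff.2 ⟨hcf, fun e he => ?_⟩
  obtain ⟨X, hXx, hX, heX⟩ := (mem_configs_iff.1 (hA hx)).2 e (he x hx)
  exact key X hX hXx e heX he

end WinskelEventStructure

/-! ### Reconstructing an event structure -/

namespace ConfigurationStructure

variable {E : Type*} (C : ConfigurationStructure E)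

/-- The event structure of a configuration structure: two distinct events are in conflict if they
never occur together, and `e` is enabled by all sets that contain the other events of some
configuration `y ∋ e` from which `e` can be removed. -/
def toWinskel : WinskelEventStructure E where
  conflict d e := d ≠ e ∧ ¬ C.Consistent {d, e}
  conflict_symm d e h := ⟨h.1.symm, Set.pair_comm d e ▸ h.2⟩
  conflict_irrefl _ h := h.1 rfl
  enables X e := X.Finite ∧ ConflictFree (fun d e => d ≠ e ∧ ¬ C.Consistent {d, e}) X ∧
    ∃ y ∈ C.configs, e ∈ y ∧ y \ {e} ∈ C.configs ∧ y \ {e} ⊆ X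
  enables_finite _ _ h := h.1
  enables_conflictFree _ _ h := h.2.1
  enables_mono := by
    rintro X Y e ⟨-, -, y, hy, hey, hy', hyX⟩ hXY hfin hcf
    exact ⟨hfin, hcf, y, hy, hey, hy', hyX.trans hXY⟩

variable {C}

theorem conflictFree_toWinskel {x : Set E} (hx : C.Consistent x) :
    ConflictFree C.toWinskel.conflict x := by
  obtain ⟨z, hz, hxz⟩ := hx
  exact fun d hd e he h => h.2 ⟨z, hz, Set.insert_subset (hxz hd)
    (Set.singleton_subset_iff.2 (hxz he))⟩

/-- Conflict is irreflexive, so conflict-freeness says nothing about singletons; `hX` supplies their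
consistency. -/
theorem pairwiseConsistent_of_conflictFree (hne : C.configs.Nonempty) {X : Set E}
    (hX : ∀ e ∈ X, ∃ z ∈ C.configs, e ∈ z) (hcf : ConflictFree C.toWinskel.conflict X) :
    C.PairwiseConsistent X := by
  refine pairwiseConsistent_of_pair hne fun d hd e he => ?_
  rcases eq_or_ne d e with rfl | hde
  · obtain ⟨z, hz, hdz⟩ := hX d hd
    exact ⟨z, hz, by simpa using hdz⟩
  · by_contra hcon
    exact hcf d hd e he ⟨hde, hcon⟩

theorem reachable_toWinskel (hr : C.Rooted) (hcf : C.CoincidenceFree)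
    (hun : C.ClosedUnderPairwiseConsistentUnions) {y : Set E} (hy : y ∈ C.configs)
    (hfin : y.Finite) : C.toWinskel.Reachable y := by
  have hT : {x | x ∈ C.configs ∧ C.toWinskel.Reachable x ∧ x ⊆ y}.Finite :=
    hfin.finite_subsets.subset fun x hx => hx.2.2
  obtain ⟨x, ⟨hx, hxr, hxy⟩, hmax⟩ :=
    hT.exists_maximal ⟨∅, hr, .empty, Set.empty_subset y⟩
  rcases hxy.eq_or_ssubset with rfl | hss
  · exact hxr
  · obtain ⟨e, hex, hins, hinsy⟩ := exists_insert_mem hcf hun hx hy hfin hss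
    have hdiff : insert e x \ {e} = x := Set.insert_sdiff_self_of_notMem hex
    have hen : C.toWinskel.enables x e :=
      ⟨hfin.subset hxy, conflictFree_toWinskel ⟨x, hx, subset_rfl⟩, insert e x, hins,
        Set.mem_insert _ _, by rwa [hdiff], hdiff.subset⟩
    exact (hex (hmax ⟨hins, hxr.step hen, hinsy⟩ (Set.subset_insert _ _)
      (Set.mem_insert _ _))).elim

theorem mem_configs_of_reachable (hr : C.Rooted) (hun : C.ClosedUnderPairwiseConsistentUnions)
    {X : Set E} (hX : C.toWinskel.Reachable X) (hcf : ConflictFree C.toWinskel.conflict X) :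
    X ∈ C.configs := by
  induction hX with
  | empty => exact hr
  | @step X e _ he ih =>
    obtain ⟨-, -, y, hy, hey, -, hyX⟩ := he
    have hX := ih (hcf.subset (Set.subset_insert _ _))
    -- Adding `e` amounts to adding `y`, since the rest of `y` is already in `X`.
    have heq : insert e X = X ∪ y := by
      refine Set.Subset.antisymm (Set.insert_subset (Or.inr hey) Set.subset_union_left)
        (Set.union_subset (Set.subset_insert _ _) ?_)
      rwa [← Set.sdiff_singleton_subset_iff]
    rw [heq] at hcf ⊢
    refine hun.union_mem hX hy (pairwiseConsistent_of_conflictFree ⟨∅, hr⟩ ?_ hcf)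
    rintro d (hd | hd)
    exacts [⟨X, hX, hd⟩, ⟨y, hy, hd⟩]

theorem toWinskel_configurationStructure (hr : C.Rooted) (hfin : C.AxiomOfFiniteness)
    (hcf : C.CoincidenceFree) (hun : C.ClosedUnderPairwiseConsistentUnions) :
    C.toWinskel.configurationStructure = C := by
  ext x
  rw [WinskelEventStructure.mem_configs_iff]
  constructor
  · rintro ⟨hxcf, hsec⟩
    have heq : ⋃₀ {y | y ∈ C.configs ∧ y ⊆ x} = x := by
      refine Set.Subset.antisymm (Set.sUnion_subset fun y hy => hy.2) fun e he => ?_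
      obtain ⟨Y, hYx, hY, heY⟩ := hsec e he
      exact ⟨Y, ⟨mem_configs_of_reachable hr hun hY (hxcf.subset hYx), hYx⟩, heY⟩
    rw [← heq]
    refine hun _ (fun y hy => hy.1) (pairwiseConsistent_of_conflictFree ⟨∅, hr⟩ ?_ ?_)
    · rintro e ⟨y, hy, hey⟩
      exact ⟨y, hy.1, hey⟩
    · rwa [heq]
  · intro hx
    refine ⟨conflictFree_toWinskel ⟨x, hx, subset_rfl⟩, fun e he => ?_⟩
    obtain ⟨y, hy, hyfin, hyx, hey⟩ := hfin.exists_finite_mem hx he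
    exact ⟨y, hyx, reachable_toWinskel hr hcf hun hy hyfin, hey⟩

/-- The configurations `x`, `y` witnessing the two enablings have a conflict-free union, which is
therefore a configuration. It bounds both `x ∩ y` and the intersection with `e` removed, so `x ∩ y`
is a witness again. -/
theorem toWinskel_stable (hun : C.ClosedUnderPairwiseConsistentUnions)
    (hint : C.ClosedUnderBoundedNonemptyIntersections) : C.toWinskel.Stable := by
  rintro X Y e ⟨hXfin, hXcf, x, hx, hex, hx', hxX⟩ ⟨-, -, y, hy, hey, hy', hyY⟩ ⟨-, hcf⟩
  have hsub : x ∪ y ⊆ X ∪ Y ∪ {e} := by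
    rw [Set.sdiff_subset_iff] at hxX hyY
    rintro d (hd | hd)
    · exact (hxX hd).elim Or.inr fun h => Or.inl (Or.inl h)
    · exact (hyY hd).elim Or.inr fun h => Or.inl (Or.inr h)
  have hxy : x ∪ y ∈ C.configs := by
    refine hun.union_mem hx hy (pairwiseConsistent_of_conflictFree ⟨x, hx⟩ ?_ (hcf.subset hsub))
    rintro d (hd | hd)
    exacts [⟨x, hx, hd⟩, ⟨y, hy, hd⟩]
  have hdiff : (x ∩ y) \ {e} = x \ {e} ∩ (y \ {e}) := inf_sdiff
  refine ⟨hXfin.subset Set.inter_subset_left, ConflictFree.subset hXcf Set.inter_subset_left,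
    x ∩ y, hint.inter_mem hx hy ⟨_, hxy, subset_rfl⟩, ⟨hex, hey⟩, ?_, ?_⟩
  · rw [hdiff]
    exact hint.inter_mem hx' hy'
      ⟨_, hxy, Set.union_subset_union Set.sdiff_subset Set.sdiff_subset⟩
  · rw [hdiff]
    exact Set.inter_subset_inter hxX hyY

end ConfigurationStructure

theorem mainTheorem11 {E : Type*} (C : ConfigurationStructure E) :
    ((∃ S : WinskelEventStructure E, S.configurationStructure = C) ↔
      C.Rooted ∧ C.AxiomOfFiniteness ∧ C.CoincidenceFree ∧
        C.ClosedUnderPairwiseConsistentUnions) ∧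
    ((∃ S : WinskelEventStructure E, S.Stable ∧ S.configurationStructure = C) ↔
      C.Rooted ∧ C.AxiomOfFiniteness ∧ C.CoincidenceFree ∧
        C.ClosedUnderPairwiseConsistentUnions ∧
        C.ClosedUnderBoundedNonemptyIntersections) := by
  refine ⟨⟨?_, ?_⟩, ⟨?_, ?_⟩⟩
  · rintro ⟨S, rfl⟩
    exact ⟨S.rooted, S.axiomOfFiniteness, S.coincidenceFree, S.closedUnderPairwiseConsistentUnions⟩
  · rintro ⟨hr, hfin, hcf, hun⟩
    exact ⟨C.toWinskel, ConfigurationStructure.toWinskel_configurationStructure hr hfin hcf hun⟩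
  · rintro ⟨S, hS, rfl⟩
    exact ⟨S.rooted, S.axiomOfFiniteness, S.coincidenceFree, S.closedUnderPairwiseConsistentUnions,
      hS.closedUnderBoundedNonemptyIntersections⟩
  · rintro ⟨hr, hfin, hcf, hun, hint⟩
    exact ⟨C.toWinskel, ConfigurationStructure.toWinskel_stable hun hint,
      ConfigurationStructure.toWinskel_configurationStructure hr hfin hcf hun⟩
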